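/- A *distance labeling scheme* for a family $\mathcal G$ of graphs consists of an encoder, which assigns to every node $u$ of every $G\in\mathcal G$ a label $e_G(u)\in\{0,1\}^*$, and a decoder $d:\{0,1\}^*\times\{0,1\}^*\to\mathbb N\cup\{\infty\}$, which sees only two labels and not the graph. Its *size* is the maximum of $|e_G(u)|$ over all $G\in\mathcal G$ and all nodes $u$ of $G$. The scheme is *$r$-additive* if $$\mathrm{dist}_G(u,v)\le d(e_G(u),e_G(v))\le \mathrm{dist}_G(u,v)+r$$ for all $G\in\mathcal G$ and all nodes $u,v$ of $G$, where $\mathrm{dist}_G(u,v)=\infty$ if $u$ and $v$ lie in different components. **Theorem.** There are absolute constants $C$ and $k$ such that for every integer $n\ge 2$ and every real $r\ge 2$ the following hold. 1. If $r\le n$, there is an $r$-additive distance labeling scheme for the family of all unweighted undirected graphs on $n$ nodes of size at most $$C\cdot\frac{n}{r}\cdot\frac{\log^k(r\log n)}{\log n}.$$ 2. Without an upper bound on $r$, there is an $r$-additive distance labeling scheme for the family of all connected unweighted undirected graphs on $n$ nodes whose size satisfies the same bound. That is, the label size is $O\!\left(\frac{n}{r}\cdot\frac{\operatorname{polylog}(r\log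 n)}{\log n}\right)$. Here $\log$ is the natural logarithm. -/

import Mathlib

/-- An encoder/decoder pair for graphs on `n` nodes. The encoder gives every node of every graph a
bit string; the decoder sees two bit strings only and returns a natural number or `∞`. -/
structure LabelingScheme (n : ℕ) where
  /-- `enc G u` is the label of the node `u` of `G`. -/
  enc : SimpleGraph (Fin n) → Fin n → List Bool
  /-- The decoder, oblivious to the graph. -/
  dec : List Bool → List Bool → ℕ∞

namespace LabelingScheme

/-- The scheme is `r`-additive on the family `𝒢`: the decoder returns an upper bound on the
distance that exceeds it by at most `r`. Distances are `∞` between different components. -/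
def IsAdditive {n : ℕ} (S : LabelingScheme n) (r : ℝ) (𝒢 : Set (SimpleGraph (Fin n))) : Prop :=
  ∀ G ∈ 𝒢, ∀ u v : Fin n,
    G.edist u v ≤ S.dec (S.enc G u) (S.enc G v) ∧
      (S.dec (S.enc G u) (S.enc G v) : ENNReal) ≤ (G.edist u v : ENNReal) + ENNReal.ofReal r

/-- The maximum label size over all graphs of `𝒢` and all their nodes is at most `b` bits. -/
def SizeLE {n : ℕ} (S : LabelingScheme n) (b : ℝ) (𝒢 : Set (SimpleGraph (Fin n))) : Prop :=
  ∀ G ∈ 𝒢, ∀ u : Fin n, ((S.enc G u).length : ℝ) ≤ b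

end LabelingScheme

/-! Put `ρ = ⌊r/2⌋`, `w = r log n`, `λ = log w`. In a connected graph every node gets a set of at
most `s = O((n/w) λ²)` hubs, such that any two nodes share a hub whose detour costs at most `2ρ ≤ r`
(`IsHubFamily`). The decoder minimises the sum of the two distances over common hubs.

Cheap labels: a walk of length below `2n` visits all nodes, and the first-chosen index of a node on
it is its position `T`. Distances from a fixed node change by at most the gap in position, so `dist
+ 2T` is strictly increasing in `T`. Two subsets of `range (5n)`, matched by rank, thus store all
hubs and their distances (`rankBelow_hubCode`). By `card_powerset_filter_card_le` with `K = w` this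
takes `O(s λ + n/w)` bits, rather than `log n` bits per hub.

Few hubs: if `log n < 72 λ`, one set meeting all balls of radius `ρ` serves everybody. Otherwise
call a node light if its `ρ`-ball has fewer than `M ≈ r log² n` nodes. Some `O(n/w)` nodes meet all
balls of non-light nodes. For `D = jρ ≈ w/λ`, a set of `O((n/D) log D)` nodes meets the geodesic
intervals of all but `(n/D)²` of the pairs at distance at least `D`, and these exceptions cost
`O(n/D)` more hubs per node. A pair at distance at most `D` either has a non-light node between its
ends, or one end reaches the other in `j` steps from light nodes; there are at most `M^j ≤ √n` such
targets (`Connected.exists_isHubFamily`).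

A disconnected graph is made connected without changing distances inside components, and the label
also names the component. -/

/-! ### Counting small subsets -/

/-- Weight a set `A` by `K ^ s * (1 / K) ^ A.card`: small sets weigh at least 1, and the total
weight over all sets is a binomial sum. -/
theorem card_powerset_filter_card_le (N s : ℕ) {K : ℝ} (hK : 1 ≤ K) :
    (((Finset.range N).powerset.filter (fun A => A.card ≤ s)).card : ℝ) ≤
      K ^ s * Real.exp (N / K) := by
  have hK0 : 0 < K := by linarith
  have h1 : ∑ A ∈ (Finset.range N).powerset, (1 / K) ^ A.card = (1 / K + 1) ^ N := by
    simpa using Finset.sum_pow_mul_eq_add_pow (1 / K) 1 (Finset.range N)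
  have h2 : (1 / K + 1) ^ N ≤ Real.exp (N / K) := by
    calc (1 / K + 1) ^ N ≤ Real.exp (1 / K) ^ N :=
          pow_le_pow_left₀ (by positivity) (Real.add_one_le_exp _) _
      _ = Real.exp (N / K) := by rw [← Real.exp_nat_mul]; congr 1; ring
  calc (((Finset.range N).powerset.filter (fun A => A.card ≤ s)).card : ℝ)
      = ∑ A ∈ (Finset.range N).powerset.filter (fun A => A.card ≤ s), (1 : ℝ) := by simp
    _ ≤ ∑ A ∈ (Finset.range N).powerset.filter (fun A => A.card ≤ s),
          K ^ s * (1 / K) ^ A.card := by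
        refine Finset.sum_le_sum fun A hA => ?_
        have hA' : A.card ≤ s := (Finset.mem_filter.1 hA).2
        rw [one_div, inv_pow, ← div_eq_mul_inv, le_div_iff₀ (by positivity), one_mul]
        exact pow_le_pow_right₀ hK hA'
    _ ≤ ∑ A ∈ (Finset.range N).powerset, K ^ s * (1 / K) ^ A.card :=
        Finset.sum_le_sum_of_subset_of_nonneg (Finset.filter_subset _ _)
          fun _ _ _ => by positivity
    _ = K ^ s * (1 / K + 1) ^ N := by rw [← Finset.mul_sum, h1]
    _ ≤ _ := by gcongr

/-! ### Encoding the distances to a set of hubs -/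

/-- The number of elements of `P` below `x`. -/
def Finset.rankBelow (P : Finset ℕ) (x : ℕ) : ℕ := (P.filter (· < x)).card

theorem Finset.rankBelow_injOn (P : Finset ℕ) {x y : ℕ} (hx : x ∈ P) (hy : y ∈ P)
    (h : P.rankBelow x = P.rankBelow y) : x = y := by
  have key : ∀ {a b : ℕ}, a ∈ P → a < b → P.rankBelow a < P.rankBelow b := by
    intro a b ha hab
    refine Finset.card_lt_card (Finset.ssubset_iff_of_subset ?_ |>.2 ⟨a, by simp [ha, hab], by simp⟩)
    intro z hz
    simp only [Finset.mem_filter] at hz ⊢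
    exact ⟨hz.1, hz.2.trans hab⟩
  rcases lt_trichotomy x y with hlt | rfl | hlt
  · exact absurd h (key hx hlt).ne
  · rfl
  · exact absurd h.symm (key hy hlt).ne

/-- The code of the restriction to `Y` of a function `f` that is Lipschitz with respect to the
positions `T`: the set of positions, and the set of the values shifted so as to be increasing. -/
def hubCode {V : Type*} (T f : V → ℕ) (Y : Finset V) : Finset ℕ × Finset ℕ :=
  (Y.image T, Y.image fun x => f x + 2 * T x)

/-- The least sum of the two values at a common position. -/
noncomputable def hubDec (p q : Finset ℕ × Finset ℕ) : ℕ∞ :=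
  ⨅ (x : ℕ) (y : ℕ) (z : ℕ) (_ : x ∈ p.1 ∧ x ∈ q.1 ∧ y ∈ p.2 ∧ z ∈ q.2 ∧
    p.2.rankBelow y = p.1.rankBelow x ∧ q.2.rankBelow z = q.1.rankBelow x),
    ((y - 2 * x + (z - 2 * x) : ℕ) : ℕ∞)

section hubCode

variable {V : Type*} {T f g : V → ℕ} {Y Z : Finset V}

/-- The hypothesis makes `f + T` nondecreasing along positions, so the second copy of `T` makes it
strictly increasing. Hence a position and its value have the same rank. -/
theorem rankBelow_hubCode (hf : ∀ x y, T x ≤ T y → f x ≤ f y + (T y - T x))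
    (hT : Function.Injective T) (x : V) :
    (hubCode T f Y).2.rankBelow (f x + 2 * T x) = (hubCode T f Y).1.rankBelow (T x) := by
  have hlt : ∀ y, f y + 2 * T y < f x + 2 * T x ↔ T y < T x := by
    intro y
    constructor
    · intro h
      by_contra hle
      rcases Nat.lt_or_ge (T x) (T y) with h1 | h1
      · have := hf x y h1.le
        omega
      · have : x = y := hT (by omega)
        subst this
        omega
    · intro h
      have := hf y x h.le
      omega
  have hinj : Function.Injective fun x => f x + 2 * T x := by
    intro y z hyz
    simp only at hyz
    rcases lt_trichotomy (T y) (T z) with h | h | h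
    · have := hf y z h.le
      omega
    · exact hT h
    · have := hf z y h.le
      omega
  simp only [hubCode, Finset.rankBelow, Finset.filter_image]
  rw [Finset.card_image_of_injective _ hinj, Finset.card_image_of_injective _ hT]
  simp only [hlt]

theorem hubDec_le (hf : ∀ x y, T x ≤ T y → f x ≤ f y + (T y - T x))
    (hg : ∀ x y, T x ≤ T y → g x ≤ g y + (T y - T x)) (hT : Function.Injective T)
    {x : V} (hx : x ∈ Y) (hx' : x ∈ Z) :
    hubDec (hubCode T f Y) (hubCode T g Z) ≤ ((f x + g x : ℕ) : ℕ∞) := by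
  unfold hubDec
  refine iInf_le_of_le (T x) (iInf_le_of_le (f x + 2 * T x) (iInf_le_of_le (g x + 2 * T x)
    (iInf_le_of_le ⟨?_, ?_, ?_, ?_, rankBelow_hubCode hf hT x, rankBelow_hubCode hg hT x⟩ ?_)))
  · exact Finset.mem_image_of_mem _ hx
  · exact Finset.mem_image_of_mem _ hx'
  · exact Finset.mem_image_of_mem (fun x => f x + 2 * T x) hx
  · exact Finset.mem_image_of_mem (fun x => g x + 2 * T x) hx'
  · simp

theorem le_hubDec (hf : ∀ x y, T x ≤ T y → f x ≤ f y + (T y - T x))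
    (hg : ∀ x y, T x ≤ T y → g x ≤ g y + (T y - T x)) (hT : Function.Injective T)
    {m : ℕ∞} (hm : ∀ x, m ≤ ((f x + g x : ℕ) : ℕ∞)) :
    m ≤ hubDec (hubCode T f Y) (hubCode T g Z) := by
  unfold hubDec
  refine le_iInf fun x => le_iInf fun y => le_iInf fun z => le_iInf ?_
  rintro ⟨hx, hxZ, hy, hz, hry, hrz⟩
  obtain ⟨v, hvY, rfl⟩ := Finset.mem_image.1 hx
  obtain ⟨w, hwZ, hw⟩ := Finset.mem_image.1 hxZ
  obtain rfl : w = v := hT hw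
  have h1 : y = f w + 2 * T w := Finset.rankBelow_injOn _ hy
    (Finset.mem_image_of_mem (fun x => f x + 2 * T x) hvY) (hry.trans (rankBelow_hubCode hf hT w).symm)
  have h2 : z = g w + 2 * T w := Finset.rankBelow_injOn _ hz
    (Finset.mem_image_of_mem (fun x => g x + 2 * T x) hwZ) (hrz.trans (rankBelow_hubCode hg hT w).symm)
  rw [h1, h2]
  simpa using hm w

end hubCode

/-! ### Positions dominating the distances of a connected graph -/

namespace SimpleGraph

variable {V : Type*} {G : SimpleGraph V}

/-- Each new node is a neighbour of the support, picked up by a detour there and back that adds 2 to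
the length. -/
theorem Connected.exists_walk_card_le_support [Fintype V] [DecidableEq V] (hG : G.Connected)
    (m : ℕ) (hm : m + 1 ≤ Fintype.card V) :
    ∃ (a b : V) (w : G.Walk a b), w.length ≤ 2 * m ∧ m + 1 ≤ w.support.toFinset.card := by
  induction m with
  | zero =>
    obtain ⟨a⟩ := hG.nonempty
    exact ⟨a, a, Walk.nil, by simp, by simp⟩
  | succ m ih =>
    obtain ⟨a, b, w, hl, hc⟩ := ih (by omega)
    by_cases hall : m + 2 ≤ w.support.toFinset.card
    · exact ⟨a, b, w, by omega, hall⟩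
    obtain ⟨z, hz⟩ : ∃ z, z ∉ w.support := by
      by_contra! h
      have : w.support.toFinset = Finset.univ := by ext; simp [h]
      rw [this, Finset.card_univ] at hall
      omega
    obtain ⟨p⟩ := hG.preconnected a z
    obtain ⟨d, -, hd1, hd2⟩ := p.exists_boundary_dart {x | x ∈ w.support} (by simp) hz
    have hx : d.fst ∈ w.support := hd1
    refine ⟨a, b, (w.takeUntil d.fst hx).append
      (Walk.cons d.adj (Walk.cons d.adj.symm (w.dropUntil d.fst hx))), ?_, ?_⟩
    · have := congrArg Walk.length (w.take_spec hx)
      simp only [Walk.length_append, Walk.length_cons] at this ⊢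
      omega
    · have hsub : insert d.snd w.support.toFinset ⊆ ((w.takeUntil d.fst hx).append
          (Walk.cons d.adj (Walk.cons d.adj.symm (w.dropUntil d.fst hx)))).support.toFinset := by
        intro y hy
        rw [Finset.mem_insert, List.mem_toFinset] at hy
        rw [List.mem_toFinset, Walk.mem_support_append_iff]
        rcases hy with rfl | hy
        · right; simp
        · rw [← w.take_spec hx, Walk.mem_support_append_iff] at hy
          rcases hy with hy | hy
          · exact Or.inl hy
          · right; simp [hy]
      have := Finset.card_le_card hsub
      rw [Finset.card_insert_of_notMem (by rw [List.mem_toFinset]; exact hd2)] at this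
      omega

theorem Walk.dist_getVert_le {a b : V} (hG : G.Connected) (w : G.Walk a b) (i k : ℕ) :
    G.dist (w.getVert i) (w.getVert (i + k)) ≤ k := by
  induction k with
  | zero => simp
  | succ k ih =>
    have h : G.dist (w.getVert (i + k)) (w.getVert (i + k + 1)) ≤ 1 := by
      rcases Nat.lt_or_ge (i + k) w.length with h | h
      · exact (dist_eq_one_iff_adj.2 (w.adj_getVert_succ h)).le
      · rw [w.getVert_of_length_le h, w.getVert_of_length_le (by omega)]
        simp
    exact (hG.dist_triangle (v := w.getVert (i + k))).trans (Nat.add_le_add ih h)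

theorem Connected.exists_position [Fintype V] (hG : G.Connected) :
    ∃ T : V → ℕ, (∀ v, T v < 2 * Fintype.card V) ∧
      ∀ u v, T u ≤ T v → G.dist u v ≤ T v - T u := by
  classical
  have : Nonempty V := hG.nonempty
  have hpos : 0 < Fintype.card V := Fintype.card_pos
  obtain ⟨a, b, w, hl, hc⟩ := hG.exists_walk_card_le_support (Fintype.card V - 1) (by omega)
  have hall : ∀ v, v ∈ w.support := by
    intro v
    have : w.support.toFinset = Finset.univ :=
      Finset.eq_univ_of_card _ (le_antisymm (Finset.card_le_univ _) (by omega))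
    rw [← List.mem_toFinset, this]
    exact Finset.mem_univ v
  have hT : ∀ v, ∃ i, w.getVert i = v ∧ i ≤ w.length := fun v =>
    (Walk.mem_support_iff_exists_getVert).1 (hall v)
  choose T hT1 hT2 using hT
  refine ⟨T, fun v => by have := hT2 v; omega, fun u v huv => ?_⟩
  have := w.dist_getVert_le hG (T u) (T v - T u)
  rwa [Nat.add_sub_cancel' huv, hT1, hT1] at this

end SimpleGraph

/-! ### Labeling schemes from finite label types -/

/-- The embedding of `X` into strings of length `b` is fixed before any graph is seen, so the
decoder can invert it. -/
theorem LabelingScheme.exists_of_finite_labels {n b : ℕ} {X : Type*} [Fintype X] [Nonempty X]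
    (hX : Fintype.card X ≤ 2 ^ b) (enc : SimpleGraph (Fin n) → Fin n → X) (dec : X → X → ℕ∞) :
    ∃ S : LabelingScheme n,
      (∀ G u v, S.dec (S.enc G u) (S.enc G v) = dec (enc G u) (enc G v)) ∧
      ∀ G u, (S.enc G u).length = b := by
  obtain ⟨e⟩ : Nonempty (X ↪ (Fin b → Bool)) :=
    Function.Embedding.nonempty_of_card_le (by simpa using hX)
  have hinj : Function.Injective fun x => List.ofFn (e x) :=
    fun x y h => e.injective (List.ofFn_injective h)
  refine ⟨⟨fun G u => List.ofFn (e (enc G u)), fun l l' =>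
    dec (Function.invFun (fun x => List.ofFn (e x)) l)
      (Function.invFun (fun x => List.ofFn (e x)) l')⟩, fun G u v => ?_, fun G u => by simp⟩
  simp only
  rw [Function.leftInverse_invFun hinj (enc G u), Function.leftInverse_invFun hinj (enc G v)]

/-! ### Hub families and the reduction to connected graphs -/

namespace SimpleGraph

variable {V : Type*}

theorem Connected.dist_lt_card [Fintype V] {G : SimpleGraph V} (hG : G.Connected) (u v : V) :
    G.dist u v < Fintype.card V := by
  obtain ⟨p, hp, hl⟩ := hG.exists_path_of_dist u v
  exact hl ▸ hp.length_lt

/-- `Y` assigns to every node a set of hubs such that any two nodes have a common hub that lies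
on a walk between them of length at most `R` above their distance. -/
def IsHubFamily (G : SimpleGraph V) (R : ℕ) (Y : V → Finset V) : Prop :=
  ∀ u v, ∃ x, x ∈ Y u ∧ x ∈ Y v ∧ G.dist u x + G.dist x v ≤ G.dist u v + R

/-- A chosen node of the component of `u`. -/
noncomputable def componentRep (G : SimpleGraph V) (u : V) : V :=
  (G.connectedComponentMk u).out

theorem reachable_componentRep (G : SimpleGraph V) (u : V) : G.Reachable (G.componentRep u) u :=
  ConnectedComponent.exact (Quot.out_eq (G.connectedComponentMk u))

theorem componentRep_eq_iff (G : SimpleGraph V) {u v : V} :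
    G.componentRep u = G.componentRep v ↔ G.Reachable u v := by
  constructor
  · intro h
    have h1 := (G.reachable_componentRep u).symm
    rw [h] at h1
    exact h1.trans (G.reachable_componentRep v)
  · intro h
    unfold componentRep
    rw [ConnectedComponent.sound h]

/-- `G` with all edges between the chosen nodes of its components added. -/
def joinComponents (G : SimpleGraph V) : SimpleGraph V :=
  G ⊔ fromRel fun u v => G.componentRep u = u ∧ G.componentRep v = v

theorem connected_joinComponents [Nonempty V] (G : SimpleGraph V) :
    G.joinComponents.Connected := by
  have hle : G ≤ G.joinComponents := le_sup_left
  have hrep : ∀ u, G.componentRep (G.componentRep u) = G.componentRep u := fun u =>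
    G.componentRep_eq_iff.2 (G.reachable_componentRep u)
  refine ⟨fun u v => ?_⟩
  refine (((G.reachable_componentRep u).mono hle).symm.trans ?_).trans
    ((G.reachable_componentRep v).mono hle)
  by_cases h : G.componentRep u = G.componentRep v
  · rw [h]
  · refine Adj.reachable (Or.inr ?_)
    simp [fromRel_adj, h, hrep]

theorem edist_joinComponents (G : SimpleGraph V) {u v : V} (h : G.Reachable u v) :
    G.joinComponents.edist u v = G.edist u v := by
  classical
  refine le_antisymm (edist_anti le_sup_left) ?_
  -- Retract onto the component of `u`: every other component collapses to the chosen node, so added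
  -- edges collapse to a point and walks do not get longer.
  let f : V → V := fun x => if G.Reachable u x then x else G.componentRep u
  have hfrep : ∀ x, G.componentRep x = x → f x = G.componentRep u := by
    intro x hx
    by_cases hr : G.Reachable u x
    · simp only [f, hr, if_true]
      rw [← hx]
      exact (G.componentRep_eq_iff.2 hr).symm
    · simp [f, hr]
  have hstep : ∀ x y, G.joinComponents.Adj x y → f x = f y ∨ G.Adj (f x) (f y) := by
    rintro x y (hxy | hxy)
    · by_cases hx : G.Reachable u x
      · have hy : G.Reachable u y := hx.trans hxy.reachable
        right
        simpa [f, hx, hy] using hxy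
      · have hy : ¬ G.Reachable u y := fun hy => hx (hy.trans hxy.symm.reachable)
        left
        simp [f, hx, hy]
    · left
      rw [fromRel_adj] at hxy
      have : G.componentRep x = x ∧ G.componentRep y = y := by tauto
      rw [hfrep x this.1, hfrep y this.2]
  have hwalk : ∀ x y (w : G.joinComponents.Walk x y), G.edist (f x) (f y) ≤ w.length := by
    intro x y w
    induction w with
    | nil => simp
    | @cons a b c hab w ih =>
      have h1 : G.edist (f a) (f b) ≤ 1 := by
        rcases hstep a b hab with h | h
        · simp [h]
        · exact (edist_eq_one_iff_adj.2 h).le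
      calc G.edist (f a) (f c) ≤ G.edist (f a) (f b) + G.edist (f b) (f c) := SimpleGraph.edist_triangle
        _ ≤ 1 + w.length := add_le_add h1 ih
        _ = _ := by simp [add_comm]
  have hfu : f u = u := by simp [f]
  have hfv : f v = v := by simp [f, h]
  refine le_iInf fun w => ?_
  simpa [hfu, hfv] using hwalk u v w

end SimpleGraph

/-- The codes of at most `s` hubs in a graph on `n` nodes. -/
def hubCodes (n s : ℕ) : Finset (Finset ℕ × Finset ℕ) :=
  ((Finset.range (5 * n)).powerset.filter (fun A => A.card ≤ s)) ×ˢ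
    ((Finset.range (5 * n)).powerset.filter (fun A => A.card ≤ s))

theorem empty_mem_hubCodes (n s : ℕ) : (∅, ∅) ∈ hubCodes n s := by simp [hubCodes]

theorem exists_hubCodes_of_isHubFamily {n s R : ℕ} {G : SimpleGraph (Fin n)} (hG : G.Connected)
    {Y : Fin n → Finset (Fin n)} (hY : G.IsHubFamily R Y) (hs : ∀ u, (Y u).card ≤ s) :
    ∃ e : Fin n → hubCodes n s, ∀ u v,
      G.edist u v ≤ hubDec (e u) (e v) ∧ hubDec (e u) (e v) ≤ G.edist u v + R := by
  obtain ⟨T, hT2, hT⟩ := hG.exists_position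
  rw [Fintype.card_fin] at hT2
  have hinj : Function.Injective T := by
    intro u v h
    have := hT u v h.le
    exact hG.dist_eq_zero_iff.1 (by omega)
  have hlip : ∀ u x y, T x ≤ T y → G.dist u x ≤ G.dist u y + (T y - T x) := by
    intro u x y hxy
    have h1 : G.dist u x ≤ G.dist u y + G.dist y x := hG.dist_triangle
    rw [G.dist_comm (u := y)] at h1
    have := hT x y hxy
    omega
  have hmem : ∀ u, hubCode T (G.dist u) (Y u) ∈ hubCodes n s := by
    intro u
    simp only [hubCode, hubCodes, Finset.mem_product, Finset.mem_filter, Finset.mem_powerset]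
    refine ⟨⟨?_, Finset.card_image_le.trans (hs u)⟩, ⟨?_, Finset.card_image_le.trans (hs u)⟩⟩
    · intro i hi
      obtain ⟨x, -, rfl⟩ := Finset.mem_image.1 hi
      have := hT2 x
      rw [Finset.mem_range]; omega
    -- Distances are below `n` and positions below `2 * n`, whence the range `5 * n`.
    · intro i hi
      obtain ⟨x, -, rfl⟩ := Finset.mem_image.1 hi
      have := hT2 x
      have h := hG.dist_lt_card u x
      rw [Fintype.card_fin] at h
      rw [Finset.mem_range]; omega
  refine ⟨fun u => ⟨_, hmem u⟩, fun u v => ⟨?_, ?_⟩⟩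
  · refine le_hubDec (hlip u) (hlip v) hinj fun x => ?_
    rw [← (hG u v).coe_dist_eq_edist]
    have h1 : G.dist u v ≤ G.dist u x + G.dist x v := hG.dist_triangle
    rw [G.dist_comm (u := x)] at h1
    exact_mod_cast h1
  · obtain ⟨x, hx, hx', h⟩ := hY u v
    refine (hubDec_le (hlip u) (hlip v) hinj hx hx').trans ?_
    rw [← (hG u v).coe_dist_eq_edist]
    rw [G.dist_comm (u := x)] at h
    exact_mod_cast h

theorem toENNReal_le_add_ofReal {a d : ℕ∞} {R : ℕ} {r : ℝ} (hr : (R : ℝ) ≤ r) (h : a ≤ d + R) :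
    (a : ENNReal) ≤ (d : ENNReal) + ENNReal.ofReal r := by
  calc (a : ENNReal) ≤ ((d + R : ℕ∞) : ENNReal) := ENat.toENNReal_le.2 h
    _ = (d : ENNReal) + (R : ENNReal) := by simp
    _ ≤ _ := by
      gcongr
      rw [← ENNReal.ofReal_natCast]
      exact ENNReal.ofReal_le_ofReal hr

theorem exists_schemes_of_isHubFamily {n s R b : ℕ} {r : ℝ} (hn : 0 < n) (hr : (R : ℝ) ≤ r)
    (hb : (hubCodes n s).card ≤ 2 ^ b)
    (hY : ∀ G : SimpleGraph (Fin n), G.Connected →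
      ∃ Y : Fin n → Finset (Fin n), G.IsHubFamily R Y ∧ ∀ u, (Y u).card ≤ s) :
    (∃ S : LabelingScheme n, S.IsAdditive r Set.univ ∧
      ∀ G u, (S.enc G u).length = b + Nat.clog 2 n) ∧
    (∃ S : LabelingScheme n, S.IsAdditive r {G | G.Connected} ∧
      ∀ G u, (S.enc G u).length = b) := by
  classical
  have : Nonempty (Fin n) := ⟨⟨0, hn⟩⟩
  have hne : Nonempty (hubCodes n s) := ⟨⟨_, empty_mem_hubCodes n s⟩⟩
  have hcard : Fintype.card (hubCodes n s) ≤ 2 ^ b := by simpa using hb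
  have key : ∀ G : SimpleGraph (Fin n), ∃ e : Fin n → hubCodes n s, G.Connected → ∀ u v,
      G.edist u v ≤ hubDec (e u) (e v) ∧ hubDec (e u) (e v) ≤ G.edist u v + R := by
    intro G
    by_cases hG : G.Connected
    · obtain ⟨Y, hY1, hY2⟩ := hY G hG
      obtain ⟨e, he⟩ := exists_hubCodes_of_isHubFamily hG hY1 hY2
      exact ⟨e, fun _ => he⟩
    · exact ⟨fun _ => hne.some, fun h => absurd h hG⟩
  choose e he using key
  constructor
  · have hcard' : Fintype.card (hubCodes n s × Fin n) ≤ 2 ^ (b + Nat.clog 2 n) := by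
      rw [Fintype.card_prod, Fintype.card_fin, pow_add]
      exact Nat.mul_le_mul hcard (Nat.le_pow_clog one_lt_two n)
    obtain ⟨S, hS, hl⟩ := LabelingScheme.exists_of_finite_labels hcard'
      (fun G u => (e G.joinComponents u, G.componentRep u))
      (fun p q => if p.2 = q.2 then hubDec p.1 q.1 else ⊤)
    refine ⟨S, fun G _ u v => ?_, hl⟩
    rw [hS]
    by_cases h : G.Reachable u v
    · have := he G.joinComponents G.connected_joinComponents u v
      rw [G.edist_joinComponents h] at this
      simp only [G.componentRep_eq_iff.2 h, if_true]
      exact ⟨this.1, toENNReal_le_add_ofReal hr this.2⟩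
    · have hne' : G.componentRep u ≠ G.componentRep v := fun h' => h (G.componentRep_eq_iff.1 h')
      have htop : G.edist u v = ⊤ := SimpleGraph.edist_eq_top_of_not_reachable h
      simp [hne', htop]
  · obtain ⟨S, hS, hl⟩ := LabelingScheme.exists_of_finite_labels hcard e
      (fun p q => hubDec p q)
    refine ⟨S, fun G hG u v => ?_, hl⟩
    rw [hS]
    exact ⟨(he G hG u v).1, toENNReal_le_add_ofReal hr (he G hG u v).2⟩

/-- Distances in a connected graph are below `n`, so the constant answer `n` is accurate enough. -/
theorem exists_scheme_connected_of_card_le {n : ℕ} {r : ℝ} (hr : (n : ℝ) ≤ r) :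
    ∃ S : LabelingScheme n, S.IsAdditive r {G | G.Connected} ∧
      ∀ G u, (S.enc G u).length = 0 := by
  refine ⟨⟨fun _ _ => [], fun _ _ => n⟩, fun G hG u v => ⟨?_, ?_⟩, by simp⟩
  · rw [← (SimpleGraph.Connected.preconnected hG u v).coe_dist_eq_edist]
    have h := SimpleGraph.Connected.dist_lt_card hG u v
    rw [Fintype.card_fin] at h
    exact Nat.cast_le.2 h.le
  · exact toENNReal_le_add_ofReal hr le_add_self

/-! ### Small hitting sets -/

/-- Greedy choice: by averaging, some node lies in at least a `D / card V` fraction of the sets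
still missed. -/
theorem exists_card_le_hitting {V ι : Type*} [Fintype V] [DecidableEq V] [Nonempty V]
    (I : Finset ι) (F : ι → Finset V) (D : ℕ) (hF : ∀ i ∈ I, D ≤ (F i).card) (k : ℕ) :
    ∃ S : Finset V, S.card ≤ k ∧ ((I.filter fun i => Disjoint (F i) S).card : ℝ) ≤
      I.card * Real.exp (-(k * D / Fintype.card V)) := by
  have hn : (0 : ℝ) < Fintype.card V := by exact_mod_cast Fintype.card_pos
  induction k with
  | zero =>
    refine ⟨∅, by simp, ?_⟩
    simp
  | succ k ih =>
    obtain ⟨S, hS, hmiss⟩ := ih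
    set R := I.filter fun i => Disjoint (F i) S with hR
    have hsum : ∑ x : V, (R.filter fun i => x ∈ F i).card = ∑ i ∈ R, (F i).card := by
      simp only [Finset.card_filter]
      rw [Finset.sum_comm]
      simp
    have hge : D * R.card ≤ ∑ i ∈ R, (F i).card := by
      rw [mul_comm, ← smul_eq_mul]
      exact Finset.card_nsmul_le_sum _ _ _ fun i hi => hF i (Finset.mem_filter.1 hi).1
    obtain ⟨x, hx⟩ : ∃ x : V, D * R.card ≤ Fintype.card V * (R.filter fun i => x ∈ F i).card := by
      by_contra! h
      have h1 := Finset.sum_lt_sum_of_nonempty (s := (Finset.univ : Finset V))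
        Finset.univ_nonempty fun x _ => h x
      rw [← Finset.mul_sum, hsum, Finset.sum_const, Finset.card_univ, smul_eq_mul] at h1
      exact absurd (Nat.lt_of_mul_lt_mul_left h1) (by omega)
    refine ⟨insert x S, (Finset.card_insert_le _ _).trans (by omega), ?_⟩
    have hsub : (I.filter fun i => Disjoint (F i) (insert x S)) ⊆ R.filter fun i => ¬ x ∈ F i := by
      intro i hi
      simp only [Finset.mem_filter, Finset.disjoint_insert_right, hR] at hi ⊢
      exact ⟨⟨hi.1, hi.2.2⟩, hi.2.1⟩
    have hcard := Finset.card_filter_add_card_filter_not (s := R) (fun i => x ∈ F i)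
    have hle : ((I.filter fun i => Disjoint (F i) (insert x S)).card : ℝ) ≤
        R.card - (R.filter fun i => x ∈ F i).card := by
      have h1 : ((I.filter fun i => Disjoint (F i) (insert x S)).card : ℝ) ≤
        ((R.filter fun i => ¬ x ∈ F i).card : ℝ) := by exact_mod_cast Finset.card_le_card hsub
      have h2 : ((R.filter fun i => x ∈ F i).card : ℝ) + ((R.filter fun i => ¬ x ∈ F i).card : ℝ) =
        R.card := by exact_mod_cast hcard
      linarith
    have hx' : (D : ℝ) / Fintype.card V * R.card ≤ (R.filter fun i => x ∈ F i).card := by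
      rw [div_mul_eq_mul_div, div_le_iff₀ hn, mul_comm _ (Fintype.card V : ℝ)]
      exact_mod_cast hx
    have hexp : 1 - (D : ℝ) / Fintype.card V ≤ Real.exp (-(D / Fintype.card V)) := by
      have := Real.add_one_le_exp (-((D : ℝ) / Fintype.card V))
      linarith
    calc ((I.filter fun i => Disjoint (F i) (insert x S)).card : ℝ)
        ≤ R.card * (1 - (D : ℝ) / Fintype.card V) := by nlinarith
      _ ≤ R.card * Real.exp (-(D / Fintype.card V)) := by gcongr
      _ ≤ I.card * Real.exp (-(k * D / Fintype.card V)) * Real.exp (-(D / Fintype.card V)) := by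
          gcongr
      _ = I.card * Real.exp (-((k + 1 : ℕ) * D / Fintype.card V)) := by
          rw [mul_assoc, ← Real.exp_add]
          congr 2
          push_cast
          ring

/-! ### Hub families -/

namespace SimpleGraph

variable {V : Type*} {G : SimpleGraph V}

theorem Connected.exists_dist_eq (hG : G.Connected) {u v : V} {t : ℕ} (ht : t ≤ G.dist u v) :
    ∃ x, G.dist u x = t ∧ G.dist x v = G.dist u v - t := by
  obtain ⟨p, hp⟩ := hG.exists_walk_length_eq_dist u v
  have h1 := p.dist_getVert_le hG 0 t
  have h2 := p.dist_getVert_le hG t (p.length - t)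
  rw [Walk.getVert_zero, zero_add] at h1
  rw [Nat.add_sub_cancel' (by omega), Walk.getVert_length] at h2
  have h3 : G.dist u v ≤ G.dist u (p.getVert t) + G.dist (p.getVert t) v := hG.dist_triangle
  exact ⟨p.getVert t, by omega, by omega⟩

variable [Fintype V]

/-- The nodes on shortest walks from `u` to `v`. -/
noncomputable def geodesicInterval (G : SimpleGraph V) (u v : V) : Finset V :=
  Finset.univ.filter fun x => G.dist u x + G.dist x v = G.dist u v

/-- The nodes at distance at most `ρ` from `u`. -/
noncomputable def distBall (G : SimpleGraph V) (ρ : ℕ) (u : V) : Finset V :=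
  Finset.univ.filter fun x => G.dist u x ≤ ρ

@[simp]
theorem mem_geodesicInterval {u v x : V} :
    x ∈ G.geodesicInterval u v ↔ G.dist u x + G.dist x v = G.dist u v := by
  simp [geodesicInterval]

@[simp]
theorem mem_distBall {ρ : ℕ} {u x : V} : x ∈ G.distBall ρ u ↔ G.dist u x ≤ ρ := by
  simp [distBall]

theorem Connected.dist_le_card_geodesicInterval (hG : G.Connected) (u v : V) :
    G.dist u v ≤ (G.geodesicInterval u v).card := by
  have hsub : Finset.range (G.dist u v) ⊆ (G.geodesicInterval u v).image (G.dist u) := by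
    intro t ht
    have ht' := (Finset.mem_range.1 ht).le
    obtain ⟨x, hx, hx'⟩ := hG.exists_dist_eq ht'
    exact Finset.mem_image.2 ⟨x, by rw [mem_geodesicInterval]; omega, hx⟩
  have := (Finset.card_le_card hsub).trans Finset.card_image_le
  rwa [Finset.card_range] at this

/-- A geodesic leaving the ball has a node at each distance `0, …, ρ`; if none leaves, the ball is
everything. -/
theorem Connected.lt_card_distBall (hG : G.Connected) {ρ : ℕ} (hρ : ρ < Fintype.card V) (u : V) :
    ρ + 1 ≤ (G.distBall ρ u).card := by
  by_cases h : ∀ v, G.dist u v ≤ ρ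
  · have : G.distBall ρ u = Finset.univ := by ext; simp [h]
    rw [this, Finset.card_univ]
    omega
  · push Not at h
    obtain ⟨v, hv⟩ := h
    have hsub : Finset.range (ρ + 1) ⊆ (G.distBall ρ u).image (G.dist u) := by
      intro t ht
      rw [Finset.mem_range] at ht
      obtain ⟨x, hx, -⟩ := hG.exists_dist_eq (show t ≤ G.dist u v by omega)
      exact Finset.mem_image.2 ⟨x, by rw [mem_distBall]; omega, hx⟩
    have := (Finset.card_le_card hsub).trans Finset.card_image_le
    rwa [Finset.card_range] at this

theorem Connected.dist_add_dist_le (hG : G.Connected) {ρ : ℕ} {u v x a : V}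
    (hx : x ∈ G.geodesicInterval u v) (ha : a ∈ G.distBall ρ x) :
    G.dist u a + G.dist a v ≤ G.dist u v + 2 * ρ := by
  rw [mem_geodesicInterval] at hx
  rw [mem_distBall] at ha
  have h1 : G.dist u a ≤ G.dist u x + G.dist x a := hG.dist_triangle
  have h2 : G.dist a v ≤ G.dist a x + G.dist x v := hG.dist_triangle
  rw [G.dist_comm (u := a) (v := x)] at h2
  omega

/-- Nodes whose ball of radius `ρ` has fewer than `M` elements. -/
def IsLight (G : SimpleGraph V) (ρ M : ℕ) (u : V) : Prop := (G.distBall ρ u).card < M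

noncomputable instance (ρ M : ℕ) : DecidablePred (G.IsLight ρ M) :=
  fun _ => Nat.decLt _ _

/-- A set of `a` nodes that meets all large balls. -/
theorem Connected.exists_hitting_balls (hG : G.Connected) {ρ M a : ℕ}
    (ha : Fintype.card V * Real.exp (-(a * M / Fintype.card V)) < 1) :
    ∃ A : Finset V, A.card ≤ a ∧
      ∀ x, ¬ G.IsLight ρ M x → ∃ y ∈ A, y ∈ G.distBall ρ x := by
  classical
  have := hG.nonempty
  obtain ⟨A, hA, hmiss⟩ := exists_card_le_hitting
    (Finset.univ.filter fun x => ¬ G.IsLight ρ M x) (G.distBall ρ) M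
    (fun x hx => not_lt.1 (Finset.mem_filter.1 hx).2) a
  refine ⟨A, hA, fun x hx => ?_⟩
  by_contra! hcon
  have hlt : ((((Finset.univ.filter fun x => ¬ G.IsLight ρ M x)).filter
      fun i => Disjoint (G.distBall ρ i) A).card : ℝ) < 1 := by
    refine hmiss.trans_lt (lt_of_le_of_lt ?_ ha)
    gcongr
    exact Finset.card_le_univ _
  have h0 : (((Finset.univ.filter fun x => ¬ G.IsLight ρ M x)).filter
      fun i => Disjoint (G.distBall ρ i) A).card = 0 := by
    have : (((Finset.univ.filter fun x => ¬ G.IsLight ρ M x)).filter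
      fun i => Disjoint (G.distBall ρ i) A).card < 1 := by exact_mod_cast hlt
    omega
  rw [Finset.card_eq_zero] at h0
  have hmem : x ∈ ((Finset.univ.filter fun x => ¬ G.IsLight ρ M x)).filter
      fun i => Disjoint (G.distBall ρ i) A := by
    simp only [Finset.mem_filter, Finset.mem_univ, true_and]
    exact ⟨hx, Finset.disjoint_left.2 fun y hy hyA => hcon y hyA hy⟩
  rw [h0] at hmem
  simp at hmem

theorem Connected.exists_isHubFamily_of_large (hG : G.Connected) {ρ a : ℕ}
    (hρ : ρ < Fintype.card V)
    (ha : Fintype.card V * Real.exp (-(a * (ρ + 1 : ℕ) / Fintype.card V)) < 1) :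
    ∃ Y : V → Finset V, G.IsHubFamily (2 * ρ) Y ∧ ∀ u, (Y u).card ≤ a := by
  obtain ⟨A, hA, hhit⟩ := hG.exists_hitting_balls (ρ := ρ) ha
  refine ⟨fun _ => A, fun u v => ?_, fun _ => hA⟩
  obtain ⟨y, hyA, hy⟩ := hhit u (not_lt.2 (hG.lt_card_distBall hρ u))
  exact ⟨y, hyA, hyA, hG.dist_add_dist_le (x := u) (by simp) hy⟩

variable [DecidableEq V]

/-- The nodes that are reached from `u` by `j` steps of length at most `ρ` that all start at
light nodes. -/
noncomputable def lightReach (G : SimpleGraph V) (ρ M : ℕ) (u : V) : ℕ → Finset V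
  | 0 => {u}
  | j + 1 => ((lightReach G ρ M u j).filter (G.IsLight ρ M)).biUnion (G.distBall ρ)

theorem card_lightReach_le (ρ M : ℕ) (u : V) (j : ℕ) : (G.lightReach ρ M u j).card ≤ M ^ j := by
  induction j with
  | zero => simp [lightReach]
  | succ j ih =>
    rw [lightReach, pow_succ]
    refine (Finset.card_biUnion_le_card_mul _ _ M fun x hx => ?_).trans ?_
    · exact (Finset.mem_filter.1 hx).2.le
    · exact Nat.mul_le_mul_right _ ((Finset.card_filter_le _ _).trans ih)

/-- Step back from `v` by `ρ` along a geodesic (or to `u`, by truncated subtraction); intervals of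
the shorter piece lie in the original one. -/
theorem Connected.mem_lightReach (hG : G.Connected) {ρ M : ℕ} {u : V} {j : ℕ} {v : V}
    (hd : G.dist u v ≤ j * ρ) (hl : ∀ x ∈ G.geodesicInterval u v, G.IsLight ρ M x) :
    v ∈ G.lightReach ρ M u j := by
  induction j generalizing v with
  | zero =>
    have : u = v := hG.dist_eq_zero_iff.1 (by omega)
    simp [lightReach, this]
  | succ j ih =>
    obtain ⟨x, hx, hx'⟩ := hG.exists_dist_eq (show G.dist u v - ρ ≤ G.dist u v by omega)
    have hxI : x ∈ G.geodesicInterval u v := by rw [mem_geodesicInterval]; omega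
    rw [add_mul, one_mul] at hd
    refine Finset.mem_biUnion.2 ⟨x, Finset.mem_filter.2 ⟨ih (by omega) fun y hy => hl y ?_,
      hl x hxI⟩, by rw [mem_distBall]; omega⟩
    rw [mem_geodesicInterval] at hy hxI ⊢
    have h1 : G.dist y v ≤ G.dist y x + G.dist x v := hG.dist_triangle
    have h2 : G.dist u v ≤ G.dist u y + G.dist y v := hG.dist_triangle
    omega

/-- Few nodes `S`, and for every `u` few nodes `X u`, such that any two nodes `u` and `v` at
distance at least `D` have a node of `S` between them unless `v ∈ X u`. -/
theorem Connected.exists_hitting_intervals (hG : G.Connected) {D k q : ℕ} (hq : 0 < q)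
    (hk : (Fintype.card V : ℝ) ^ 2 * Real.exp (-(k * D / Fintype.card V)) ≤ (q : ℝ) ^ 2) :
    ∃ (S : Finset V) (X : V → Finset V), S.card ≤ k + q ∧ (∀ u, (X u).card ≤ q) ∧
      ∀ u v, D ≤ G.dist u v → v ∈ X u ∨ ∃ x ∈ S, x ∈ G.geodesicInterval u v := by
  have := hG.nonempty
  obtain ⟨S, hS, hmiss⟩ := exists_card_le_hitting
    ((Finset.univ : Finset (V × V)).filter fun p => D ≤ G.dist p.1 p.2)
    (fun p => G.geodesicInterval p.1 p.2) D
    (fun p hp => le_trans (Finset.mem_filter.1 hp).2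
      (hG.dist_le_card_geodesicInterval p.1 p.2)) k
  set miss : V → Finset V := fun u =>
    Finset.univ.filter fun v => D ≤ G.dist u v ∧ Disjoint (G.geodesicInterval u v) S with hmissdef
  have htot : ∑ u, (miss u).card ≤ q ^ 2 := by
    have heq : ∑ u, (miss u).card = (((Finset.univ : Finset (V × V)).filter
        fun p => D ≤ G.dist p.1 p.2).filter
          fun p => Disjoint (G.geodesicInterval p.1 p.2) S).card := by
      rw [Finset.filter_filter, Finset.card_filter, Fintype.sum_prod_type]
      simp only [hmissdef, Finset.card_filter]
    have hle : (((Finset.univ : Finset (V × V)).filter fun p => D ≤ G.dist p.1 p.2).card : ℝ) ≤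
        (Fintype.card V : ℝ) ^ 2 := by
      have h := Finset.card_le_univ ((Finset.univ : Finset (V × V)).filter
        fun p => D ≤ G.dist p.1 p.2)
      rw [Fintype.card_prod, ← sq] at h
      calc _ ≤ ((Fintype.card V ^ 2 : ℕ) : ℝ) := Nat.cast_le.2 h
        _ = _ := by push_cast; rfl
    rw [heq]
    have : ((((Finset.univ : Finset (V × V)).filter
        fun p => D ≤ G.dist p.1 p.2).filter
          fun p => Disjoint (G.geodesicInterval p.1 p.2) S).card : ℝ) ≤ (q : ℝ) ^ 2 :=
      hmiss.trans (le_trans (mul_le_mul_of_nonneg_right hle (Real.exp_pos _).le) hk)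
    exact_mod_cast this
  -- Nodes with too many missed partners are few, and they join the hitting set: each lies in its
  -- own intervals.
  set bad : Finset V := Finset.univ.filter fun u => q < (miss u).card with hbad
  have hbadcard : bad.card ≤ q := by
    have h1 : bad.card * q ≤ ∑ u ∈ bad, (miss u).card := by
      rw [← smul_eq_mul]
      exact Finset.card_nsmul_le_sum _ _ _ fun u hu => (Finset.mem_filter.1 hu).2.le
    have h2 : ∑ u ∈ bad, (miss u).card ≤ ∑ u, (miss u).card :=
      Finset.sum_le_sum_of_subset (Finset.subset_univ _)
    have h3 : bad.card * q ≤ q * q := by rw [← sq]; omega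
    exact Nat.le_of_mul_le_mul_right h3 hq
  refine ⟨S ∪ bad, fun u => if u ∈ bad then ∅ else miss u,
    (Finset.card_union_le _ _).trans (by omega), fun u => ?_, fun u v huv => ?_⟩
  · by_cases hu : u ∈ bad
    · simp [hu]
    · simp only [hu, if_false]
      simpa [hbad] using hu
  · by_cases hu : u ∈ bad
    · exact Or.inr ⟨u, Finset.mem_union_right _ hu, by simp⟩
    · by_cases hdis : Disjoint (G.geodesicInterval u v) S
      · left
        simp only [hu, if_false]
        simp [hmissdef, huv, hdis]
      · obtain ⟨x, hx, hxS⟩ := Finset.not_disjoint_iff.1 hdis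
        exact Or.inr ⟨x, Finset.mem_union_left _ hxS, hx⟩

theorem Connected.exists_isHubFamily (hG : G.Connected) {ρ M j a k q : ℕ} (hq : 0 < q)
    (ha : Fintype.card V * Real.exp (-(a * M / Fintype.card V)) < 1)
    (hk : (Fintype.card V : ℝ) ^ 2 * Real.exp (-(k * (j * ρ : ℕ) / Fintype.card V)) ≤
      (q : ℝ) ^ 2) :
    ∃ Y : V → Finset V, G.IsHubFamily (2 * ρ) Y ∧
      ∀ u, (Y u).card ≤ 1 + (k + q) + q + a + M ^ j := by
  obtain ⟨A, hA, hhit⟩ := hG.exists_hitting_balls (ρ := ρ) ha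
  obtain ⟨S, X, hS, hX, hSX⟩ := hG.exists_hitting_intervals hq hk
  refine ⟨fun u => {u} ∪ S ∪ X u ∪ A ∪ G.lightReach ρ M u j, fun u v => ?_, fun u => ?_⟩
  · rcases le_total (j * ρ) (G.dist u v) with hd | hd
    · rcases hSX u v hd with hv | ⟨x, hxS, hx⟩
      · exact ⟨v, by simp [hv], by simp, by simp⟩
      · rw [mem_geodesicInterval] at hx
        exact ⟨x, by simp [hxS], by simp [hxS], by omega⟩
    · by_cases hl : ∀ x ∈ G.geodesicInterval u v, G.IsLight ρ M x
      -- Storing `v` at `u` suffices, since every node is its own hub.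
      · exact ⟨v, by simp [hG.mem_lightReach hd hl], by simp, by simp⟩
      · push Not at hl
        obtain ⟨x, hx, hxl⟩ := hl
        obtain ⟨y, hyA, hy⟩ := hhit x hxl
        exact ⟨y, by simp [hyA], by simp [hyA], hG.dist_add_dist_le hx hy⟩
  · refine (Finset.card_union_le _ _).trans (Nat.add_le_add ?_ (card_lightReach_le ρ M u j))
    refine (Finset.card_union_le _ _).trans (Nat.add_le_add ?_ hA)
    refine (Finset.card_union_le _ _).trans (Nat.add_le_add ?_ (hX u))
    exact (Finset.card_union_le _ _).trans (Nat.add_le_add (by simp) hS)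

end SimpleGraph

/-! ### Choice of the parameters -/

theorem natCast_mul_exp_neg_lt_one {n : ℕ} (hn : 0 < n) {x : ℝ} (hx : Real.log n < x) :
    (n : ℝ) * Real.exp (-x) < 1 := by
  have hn' : (0 : ℝ) < n := by exact_mod_cast hn
  calc (n : ℝ) * Real.exp (-x) < n * Real.exp (-Real.log n) := by gcongr
    _ = 1 := by rw [Real.exp_neg, Real.exp_log hn', mul_inv_cancel₀ hn'.ne']

theorem lt_log_natCast_of_two_le {n : ℕ} (hn : 2 ≤ n) : 0.69 < Real.log n := by
  have h1 : Real.log 2 ≤ Real.log n := Real.log_le_log (by norm_num) (by exact_mod_cast hn)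
  have := Real.log_two_gt_d9
  linarith

theorem quarter_le_log_mul_log {n : ℕ} {r : ℝ} (hn : 2 ≤ n) (hr : 2 ≤ r) :
    1 / 4 ≤ Real.log (r * Real.log n) := by
  have hl := lt_log_natCast_of_two_le hn
  have hw : 1.38 ≤ r * Real.log n := by nlinarith
  have h1 := Real.one_sub_inv_le_log_of_pos (x := r * Real.log n) (by linarith)
  have h2 : (r * Real.log n)⁻¹ ≤ (1.38)⁻¹ := inv_anti₀ (by norm_num) hw
  have h3 : (1.38 : ℝ)⁻¹ ≤ 3 / 4 := by norm_num
  linarith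

theorem quarter_le_floor_half {r : ℝ} (hr : 2 ≤ r) : r / 4 ≤ ⌊r / 2⌋₊ := by
  have h1 : (1 : ℝ) ≤ ⌊r / 2⌋₊ := by exact_mod_cast (Nat.le_floor (by norm_num; linarith))
  have h2 := Nat.lt_floor_add_one (r / 2)
  linarith

/-- Hub families when `r` is at least a small power of `n`. -/
theorem exists_isHubFamily_of_log_lt {n : ℕ} {r : ℝ} (hn : 2 ≤ n) (hr : 2 ≤ r) (hrn : r ≤ n)
    (hcase : Real.log n < 72 * Real.log (r * Real.log n)) :
    ∃ s : ℕ, (s : ℝ) ≤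
        11000 * (n / (r * Real.log n) * Real.log (r * Real.log n) ^ 2) ∧
      ∀ G : SimpleGraph (Fin n), G.Connected →
        ∃ Y : Fin n → Finset (Fin n), G.IsHubFamily (2 * ⌊r / 2⌋₊) Y ∧ ∀ u, (Y u).card ≤ s := by
  have hl := lt_log_natCast_of_two_le hn
  have hlam := quarter_le_log_mul_log hn hr
  set l := Real.log n with hldef
  set lam := Real.log (r * l)
  have hr0 : 0 < r := by linarith
  have hn0 : (0 : ℝ) < n := by linarith
  have hl0 : 0 < l := by linarith
  have hfl : (⌊r / 2⌋₊ : ℝ) ≤ r / 2 := Nat.floor_le (by linarith)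
  have hfl2 := Nat.lt_floor_add_one (r / 2)
  have hρn : ⌊r / 2⌋₊ < n := by
    have : (⌊r / 2⌋₊ : ℝ) < n := by linarith
    exact_mod_cast this
  refine ⟨⌈2 * n * l / r⌉₊, ?_, fun G hG => hG.exists_isHubFamily_of_large ?_ ?_⟩
  · have h1 := (Nat.ceil_lt_add_one (show 0 ≤ 2 * n * l / r by positivity)).le
    have h2 : 2 * n * l / r = n / (r * l) * (2 * l ^ 2) := by field_simp
    have h3 : 1 ≤ n / (r * l) * l := by
      rw [show n / (r * l) * l = n / r by field_simp, le_div_iff₀ hr0]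
      linarith
    -- `5184 = 72 ^ 2` and `288 = 4 * 72`, using `1 / 4 ≤ lam`; the constant 11000 covers `2 * 5184
    -- + 288`.
    have h4 : l ^ 2 ≤ 5184 * lam ^ 2 := by nlinarith
    have h5 : l ≤ 288 * lam ^ 2 := by nlinarith
    calc (⌈2 * n * l / r⌉₊ : ℝ) ≤ n / (r * l) * (2 * l ^ 2) + n / (r * l) * l := by linarith
      _ = n / (r * l) * (2 * l ^ 2 + l) := by ring
      _ ≤ n / (r * l) * (11000 * lam ^ 2) := by
        gcongr
        nlinarith
      _ = _ := by ring
  · simpa using hρn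
  · rw [Fintype.card_fin]
    refine natCast_mul_exp_neg_lt_one (by omega) ?_
    rw [lt_div_iff₀ hn0]
    have h1 : 2 * n * l / r ≤ ⌈2 * n * l / r⌉₊ := Nat.le_ceil _
    have h0 : 0 < 2 * n * l / r := by positivity
    push_cast
    calc l * n = 2 * n * l / r * (r / 2) := by field_simp
      _ < 2 * n * l / r * (⌊r / 2⌋₊ + 1) := by gcongr
      _ ≤ _ := by gcongr

/-- Hub families when `r` is less than a small power of `n`. -/
theorem exists_isHubFamily_of_le_log {n M : ℕ} {r : ℝ} (hn : 2 ≤ n) (hr : 2 ≤ r)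
    (hM : r * Real.log n ^ 2 ≤ M) (hM3 : 3 ≤ M)
    (hMlam : Real.log M ≤ 18 * Real.log (r * Real.log n)) (hcase : 4 * Real.log M ≤ Real.log n) :
    ∃ s : ℕ, (s : ℝ) ≤
        11000 * (n / (r * Real.log n) * Real.log (r * Real.log n) ^ 2) ∧
      ∀ G : SimpleGraph (Fin n), G.Connected →
        ∃ Y : Fin n → Finset (Fin n), G.IsHubFamily (2 * ⌊r / 2⌋₊) Y ∧ ∀ u, (Y u).card ≤ s := by
  have hl := lt_log_natCast_of_two_le hn
  have hlam := quarter_le_log_mul_log hn hr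
  have hn0 : (0 : ℝ) < n := by positivity
  have hexpl : Real.exp (Real.log n) = n := Real.exp_log hn0
  set l := Real.log n with hldef
  set w := r * l with hw
  set lam := Real.log w
  have hr0 : 0 < r := by linarith
  have hl0 : 0 < l := by linarith
  have hw0 : 0 < w := by positivity
  have hM3' : (3 : ℝ) ≤ M := by exact_mod_cast hM3
  have hM0 : (0 : ℝ) < M := by linarith
  have hlogM : 1 ≤ Real.log M := by
    rw [Real.le_log_iff_exp_le hM0]
    have := Real.exp_one_lt_d9
    linarith
  have hfl : (⌊r / 2⌋₊ : ℝ) ≤ r / 2 := Nat.floor_le (by linarith)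
  have hfl4 := quarter_le_floor_half hr
  have hMexp : (M : ℝ) ≤ Real.exp (l / 4) := by
    rw [← Real.exp_log hM0]
    gcongr
    linarith
  have hβ : Real.exp (l / 2) ≤ 2 * (n / w) := by
    have h1 : w ≤ 2 * Real.exp (l / 2) := by
      have h2 : w ≤ 2 * (r * l ^ 2) := by
        have := mul_le_mul_of_nonneg_left hl.le hw0.le
        rw [show r * l ^ 2 = w * l by rw [hw]; ring]
        linarith
      have h3 : Real.exp (l / 4) ≤ Real.exp (l / 2) := by gcongr; linarith
      linarith
    rw [← hexpl, ← mul_div_assoc, le_div_iff₀ hw0]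
    calc Real.exp (l / 2) * w ≤ Real.exp (l / 2) * (2 * Real.exp (l / 2)) := by gcongr
      _ = 2 * (Real.exp (l / 2 + l / 2)) := by rw [Real.exp_add]; ring
      _ = _ := by ring_nf
  have hβ1 : 1 ≤ 2 * (n / w) := le_trans (Real.one_le_exp (by linarith)) hβ
  have hβ0 : 0 < n / w := by positivity
  set β := n / w with hβdef
  -- Nearly the largest `j` with `M ^ j ≤ √n`; by `hβ`, `√n` is within the budget `2 * β`.
  set j := ⌊l / (2 * Real.log M)⌋₊ with hj
  have hj1 : (j : ℝ) ≤ l / (2 * Real.log M) := Nat.floor_le (by positivity)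
  have hj2 : l / (4 * Real.log M) ≤ j := by
    have h1 : 2 ≤ l / (2 * Real.log M) := by
      rw [le_div_iff₀ (by linarith)]
      linarith
    have h2 := Nat.lt_floor_add_one (l / (2 * Real.log M))
    have h3 : l / (4 * Real.log M) = l / (2 * Real.log M) / 2 := by field_simp; norm_num
    rw [h3]
    linarith
  have hMj : (M : ℝ) ^ j ≤ Real.exp (l / 2) := by
    rw [show (M : ℝ) ^ j = Real.exp (j * Real.log M) by rw [Real.exp_nat_mul, Real.exp_log hM0]]
    gcongr
    calc (j : ℝ) * Real.log M ≤ l / (2 * Real.log M) * Real.log M := by gcongr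
      _ = l / 2 := by field_simp
  set D := j * ⌊r / 2⌋₊ with hD
  have hDcast : (D : ℝ) = j * ⌊r / 2⌋₊ := by rw [hD]; push_cast; rfl
  have hD1 : w / (288 * lam) ≤ D := by
    have h16 : w / (288 * lam) ≤ l / (4 * Real.log M) * (r / 4) := by
      rw [div_mul_div_comm, div_le_div_iff₀ (by positivity) (by positivity), hw]
      have := mul_le_mul_of_nonneg_left hMlam hw0.le
      linarith
    rw [hDcast]
    exact h16.trans (by gcongr)
  have hD0 : (0 : ℝ) < D := lt_of_lt_of_le (by positivity) hD1
  have hDw : (D : ℝ) ≤ w := by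
    have h1 : l / (2 * Real.log M) ≤ l := div_le_self hl0.le (by linarith)
    rw [hDcast, hw, mul_comm r]
    exact mul_le_mul (by linarith) (by linarith) (by positivity) hl0.le
  have hDge : (1 : ℝ) ≤ D := by exact_mod_cast (Nat.cast_pos.1 hD0)
  have hlogD0 : 0 ≤ Real.log D := Real.log_nonneg hDge
  have hlogD : Real.log D ≤ lam := Real.log_le_log hD0 hDw
  have hnD : n / (D : ℝ) ≤ 288 * lam * β := by
    calc n / (D : ℝ) ≤ n / (w / (288 * lam)) := by gcongr
      _ = 288 * lam * β := by rw [hβdef]; field_simp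
  set q := ⌈n / (D : ℝ)⌉₊ with hq
  -- Hitting every interval would cost a factor `log n`; tolerating `(n / D) ^ 2 ≤ q ^ 2` missed
  -- pairs lowers it to `log D ≤ lam`.
  set k := ⌈2 * (n / (D : ℝ)) * Real.log D⌉₊ with hk
  set a := ⌈2 * n * l / M⌉₊ with ha
  have hqle : (q : ℝ) ≤ n / (D : ℝ) + 1 := (Nat.ceil_lt_add_one (by positivity)).le
  have hkle : (k : ℝ) ≤ 2 * (n / (D : ℝ)) * Real.log D + 1 :=
    (Nat.ceil_lt_add_one (by positivity)).le
  have hale : (a : ℝ) ≤ 2 * β + 1 := by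
    have h1 : (a : ℝ) ≤ 2 * n * l / M + 1 := (Nat.ceil_lt_add_one (by positivity)).le
    have h2 : 2 * n * l / M ≤ 2 * n * l / (r * l ^ 2) := by gcongr
    have h3 : 2 * n * l / (r * l ^ 2) = 2 * β := by rw [hβdef, hw]; field_simp
    linarith
  refine ⟨1 + (k + q) + q + a + M ^ j, ?_, fun G hG => hG.exists_isHubFamily ?_ ?_ ?_⟩
  · have h1 : 2 * (n / (D : ℝ)) * Real.log D ≤ 2 * (288 * lam * β) * lam := by gcongr
    have h3 : lam * β ≤ 4 * (β * lam ^ 2) := by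
      have := mul_le_mul_of_nonneg_left hlam (show 0 ≤ lam * β by positivity)
      linarith
    have h2 : β ≤ 16 * (β * lam ^ 2) := by
      have := mul_le_mul_of_nonneg_left hlam hβ0.le
      linarith
    push_cast
    linarith
  · exact Nat.ceil_pos.2 (by positivity)
  · rw [Fintype.card_fin]
    refine natCast_mul_exp_neg_lt_one (by omega) ?_
    have h1 : 2 * n * l / M ≤ a := Nat.le_ceil _
    rw [div_le_iff₀ hM0] at h1
    rw [lt_div_iff₀ hn0]
    linarith [mul_pos hn0 hl0]
  · rw [Fintype.card_fin]
    have h1 : 2 * (n / (D : ℝ)) * Real.log D ≤ k := Nat.le_ceil _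
    have h2 : 2 * Real.log D ≤ k * D / n := by
      rw [le_div_iff₀ hn0]
      calc 2 * Real.log D * n = 2 * (n / (D : ℝ)) * Real.log D * D := by field_simp
        _ ≤ _ := by gcongr
    calc (n : ℝ) ^ 2 * Real.exp (-(k * (D : ℕ) / n)) ≤ n ^ 2 * Real.exp (-(2 * Real.log D)) := by
          gcongr
      _ = (n / (D : ℝ)) ^ 2 := by
          rw [Real.exp_neg, two_mul, Real.exp_add, Real.exp_log hD0]
          field_simp
      _ ≤ _ := by
          gcongr
          exact Nat.le_ceil _

theorem exists_isHubFamily_card_le {n : ℕ} {r : ℝ} (hn : 2 ≤ n) (hr : 2 ≤ r) (hrn : r ≤ n) :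
    Real.log n ≤ 11000 * (n / (r * Real.log n) * Real.log (r * Real.log n) ^ 2) ∧
    ∃ s : ℕ, (s : ℝ) ≤
        11000 * (n / (r * Real.log n) * Real.log (r * Real.log n) ^ 2) ∧
      ∀ G : SimpleGraph (Fin n), G.Connected →
        ∃ Y : Fin n → Finset (Fin n), G.IsHubFamily (2 * ⌊r / 2⌋₊) Y ∧ ∀ u, (Y u).card ≤ s := by
  have hl := lt_log_natCast_of_two_le hn
  have hlam := quarter_le_log_mul_log hn hr
  have hn0 : (0 : ℝ) < n := by positivity
  have hr0 : 0 < r := by linarith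
  have hl0 : 0 < Real.log n := by linarith
  by_cases hcase : Real.log n < 72 * Real.log (r * Real.log n)
  · refine ⟨?_, exists_isHubFamily_of_log_lt hn hr hrn hcase⟩
    set l := Real.log n
    set lam := Real.log (r * l)
    have h4 : l ^ 2 ≤ 5184 * lam ^ 2 := by nlinarith
    have h3 : l * (r * l) ≤ n * l ^ 2 := by
      have := mul_le_mul_of_nonneg_right hrn (sq_nonneg l)
      nlinarith
    calc l ≤ n / (r * l) * l ^ 2 := by
          rw [div_mul_eq_mul_div, le_div_iff₀ (by positivity)]
          exact h3
      _ ≤ n / (r * l) * (11000 * lam ^ 2) := by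
          gcongr
          nlinarith [sq_nonneg lam]
      _ = _ := by ring
  · push Not at hcase
    -- The `3` ensures `1 ≤ log M`. Since `18 * 4 = 72`, the case hypothesis gives `4 * log M ≤ log
    -- n`.
    set M := ⌈r * Real.log n ^ 2⌉₊ + 3 with hMdef
    have hM : r * Real.log n ^ 2 ≤ M := by
      rw [hMdef]
      push_cast
      linarith [Nat.le_ceil (r * Real.log n ^ 2)]
    have hM0 : (0 : ℝ) < M := by rw [hMdef]; positivity
    have hMlam : Real.log M ≤ 18 * Real.log (r * Real.log n) := by
      have hw1 : 1 ≤ r * Real.log n := by nlinarith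
      have h1 : (M : ℝ) ≤ 5 * (r * Real.log n) ^ 2 := by
        have h2 := (Nat.ceil_lt_add_one (show 0 ≤ r * Real.log n ^ 2 by positivity)).le
        have h3 : r * Real.log n ^ 2 ≤ (r * Real.log n) ^ 2 := by
          rw [mul_pow]
          gcongr
          nlinarith
        have h4 : 1 ≤ (r * Real.log n) ^ 2 := one_le_pow₀ hw1
        rw [hMdef]
        push_cast
        linarith
      have h5 : Real.log 5 ≤ 4 := by
        have := Real.log_le_sub_one_of_pos (show (0 : ℝ) < 5 by norm_num)
        linarith
      calc Real.log M ≤ Real.log (5 * (r * Real.log n) ^ 2) := Real.log_le_log hM0 h1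
        _ = Real.log 5 + 2 * Real.log (r * Real.log n) := by
          rw [Real.log_mul (by norm_num) (by positivity), Real.log_pow]
          norm_num
        _ ≤ _ := by linarith
    refine ⟨?_, exists_isHubFamily_of_le_log hn hr hM (by omega) hMlam (by linarith)⟩
    have hMn : (M : ℝ) ≤ n := by
      rw [← Real.log_le_log_iff hM0 hn0]
      linarith
    calc Real.log n ≤ n / (r * Real.log n) * 1 := by
          rw [mul_one, le_div_iff₀ (by positivity)]
          nlinarith
      _ ≤ n / (r * Real.log n) * (11000 * Real.log (r * Real.log n) ^ 2) := by
          gcongr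
          nlinarith
      _ = _ := by ring

/-! ### Bit counts and assembly of the schemes -/

theorem card_hubCodes_le {n s : ℕ} {K : ℝ} (hK : 1 ≤ K) :
    ((hubCodes n s).card : ℝ) ≤ Real.exp (2 * (s * Real.log K) + 10 * (n / K)) := by
  have h := card_powerset_filter_card_le (5 * n) s hK
  rw [hubCodes, Finset.card_product]
  push_cast at h ⊢
  have hK0 : 0 < K := by linarith
  calc _ ≤ (K ^ s * Real.exp (5 * n / K)) * (K ^ s * Real.exp (5 * n / K)) := by gcongr
    _ = (Real.exp (s * Real.log K) * Real.exp (5 * n / K)) *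
          (Real.exp (s * Real.log K) * Real.exp (5 * n / K)) := by
        rw [Real.exp_nat_mul, Real.exp_log hK0]
    _ = _ := by
        rw [← Real.exp_add, ← Real.exp_add]
        congr 1
        ring

theorem natClog_two_le {n : ℕ} (hn : 2 ≤ n) : (Nat.clog 2 n : ℝ) ≤ 2 * Real.log n + 1 := by
  have h1 := Nat.pow_pred_clog_lt_self one_lt_two (show 1 < n by omega)
  have hn0 : (0 : ℝ) < n := by positivity
  have h2 : ((2 : ℝ) ^ (Nat.clog 2 n).pred) ≤ n := by exact_mod_cast h1.le
  have h3 := Real.log_le_log (by positivity) h2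
  rw [Real.log_pow] at h3
  have h4 : (Nat.clog 2 n : ℝ) ≤ (Nat.clog 2 n).pred + 1 := by
    have : Nat.clog 2 n ≤ (Nat.clog 2 n).pred + 1 := by rw [Nat.pred_eq_sub_one]; omega
    exact_mod_cast this
  have h5 := Real.log_two_gt_d9
  have h6 : (0 : ℝ) ≤ (Nat.clog 2 n).pred := by positivity
  nlinarith

theorem theorem2 :
    ∃ (C : ℝ) (k : ℕ), ∀ (n : ℕ) (r : ℝ), 2 ≤ n → 2 ≤ r →
      (r ≤ n → ∃ S : LabelingScheme n,
        S.IsAdditive r Set.univ ∧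
        S.SizeLE (C * ((n / r) * (Real.log (r * Real.log n) ^ k / Real.log n))) Set.univ) ∧
      (∃ S : LabelingScheme n,
        S.IsAdditive r {G | G.Connected} ∧
        S.SizeLE (C * ((n / r) * (Real.log (r * Real.log n) ^ k / Real.log n)))
          {G | G.Connected}) := by
  -- Two logarithmic factors come from the number of hubs, the third from the bits per hub.
  refine ⟨1000000, 3, fun n r hn hr => ?_⟩
  have hl := lt_log_natCast_of_two_le hn
  have hlam := quarter_le_log_mul_log hn hr
  have hn0 : (0 : ℝ) < n := by positivity
  have hr0 : 0 < r := by linarith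
  have hl0 : 0 < Real.log n := by linarith
  by_cases hrn : r ≤ n
  · obtain ⟨hlog, s, hs, hY⟩ := exists_isHubFamily_card_le hn hr hrn
    have hrew : (n / r) * (Real.log (r * Real.log n) ^ 3 / Real.log n) =
        n / (r * Real.log n) * Real.log (r * Real.log n) ^ 3 := by field_simp
    rw [hrew]
    have hK : 1 ≤ r * Real.log n := by nlinarith
    set E := 2 * (s * Real.log (r * Real.log n)) + 10 * (n / (r * Real.log n)) with hE
    have hE0 : 0 ≤ E := by positivity
    have hlog2 := Real.log_two_gt_d9
    -- `2 * E` bits cover `exp E` codes because `1 / 2 < log 2`.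
    have hb : (hubCodes n s).card ≤ 2 ^ ⌈2 * E⌉₊ := by
      have h : ((hubCodes n s).card : ℝ) ≤ (2 : ℝ) ^ ⌈2 * E⌉₊ := by
        refine (card_hubCodes_le hK).trans ?_
        rw [show (2 : ℝ) ^ ⌈2 * E⌉₊ = Real.exp (⌈2 * E⌉₊ * Real.log 2) by
          rw [Real.exp_nat_mul, Real.exp_log two_pos]]
        gcongr
        have := Nat.le_ceil (2 * E)
        nlinarith
      exact_mod_cast h
    have hble : (⌈2 * E⌉₊ : ℝ) ≤ 2 * E + 1 := (Nat.ceil_lt_add_one (by positivity)).le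
    have hR : ((2 * ⌊r / 2⌋₊ : ℕ) : ℝ) ≤ r := by
      have := Nat.floor_le (show 0 ≤ r / 2 by linarith)
      push_cast
      linarith
    obtain ⟨⟨S, hS, hSl⟩, S', hS', hSl'⟩ :=
      exists_schemes_of_isHubFamily (show 0 < n by omega) hR hb hY
    have hsize : (⌈2 * E⌉₊ : ℝ) + Nat.clog 2 n ≤
        1000000 * (n / (r * Real.log n) * Real.log (r * Real.log n) ^ 3) := by
      have hc := natClog_two_le hn
      have hβ0 : 0 < n / (r * Real.log n) := by positivity
      set lam := Real.log (r * Real.log n)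
      set β := n / (r * Real.log n)
      have h1 : s * lam ≤ 11000 * (β * lam ^ 3) := by
        calc s * lam ≤ 11000 * (β * lam ^ 2) * lam := by gcongr
          _ = _ := by ring
      have h2 : β * lam ^ 2 ≤ 4 * (β * lam ^ 3) := by
        have : 0 < β * lam ^ 2 := by positivity
        nlinarith
      have h3 : β ≤ 16 * (β * lam ^ 2) := by
        have : 1 ≤ 16 * lam ^ 2 := by nlinarith
        nlinarith
      linarith
    have hsize' : (⌈2 * E⌉₊ : ℝ) ≤
        1000000 * (n / (r * Real.log n) * Real.log (r * Real.log n) ^ 3) :=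
      le_trans (le_add_of_nonneg_right (Nat.cast_nonneg _)) hsize
    refine ⟨fun _ => ⟨S, hS, fun G _ u => ?_⟩, S', hS', fun G _ u => ?_⟩
    · rw [hSl]
      push_cast
      exact hsize
    · rw [hSl']
      exact hsize'
  · refine ⟨fun h => absurd h hrn, ?_⟩
    obtain ⟨S, hS, hSl⟩ := exists_scheme_connected_of_card_le (not_le.1 hrn).le
    refine ⟨S, hS, fun G _ u => ?_⟩
    rw [hSl]
    have : 0 < Real.log (r * Real.log n) := by linarith
    simp only [Nat.cast_zero]
    positivity
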